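/- Let $V, W \subset \mathbb{R}^2$ be (closed, bounded) simply connected domains, that is, compact sets, each the closure of its interior, whose interiors $\mathring V, \mathring W$ are simply connected; write $\partial V, \partial W$ for their boundaries. Let $F=(u,v)$ be a map $V \to \mathbb{R}^2$ that is continuous on $V$ and $C^1$ in $\mathring V$, and suppose that $F$ is harmonic, i.e. $\Delta u = \Delta v = 0$ in $\mathring V$. Suppose that $F|_{\partial V}$ is an orientation-preserving homeomorphism from $\partial V$ onto $\partial W$, i.e. a homeomorphism which carries a counterclockwise parametrization of the simple closed curve $\partial V$ to a counterclockwise parametrization of $\partial W$. If $W$ is convex, then $F$ is a bijection from $V$ onto $W$. -/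

import Mathlib

open Set

namespace HarmonicBijection

/-! The plane is `ℂ` (that is, the Euclidean plane with coordinates `re`, `im`). -/

/-- A (closed, bounded) simply connected planar domain: a compact set which is the closure of its
interior and whose interior is simply connected (in particular non-empty and connected). -/
structure IsSimplyConnectedDomain (V : Set ℂ) : Prop where
  isCompact : IsCompact V
  closure_interior : closure (interior V) = V
  simplyConnected : IsSimplyConnected (interior V)

/-- `F`, restricted to `A`, is a homeomorphism from `A` onto `B`. -/
def RestrictsToHomeo (F : ℂ → ℂ) (A B : Set ℂ) : Prop :=
  ∃ h : A ≃ₜ B, ∀ x : A, (h x : ℂ) = F x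

/-- The curve `γ`, defined on `[0, 1]`, avoids `p` and winds `n` times around `p`: a continuous
choice `θ` of the argument of `γ - p` grows by `2 π n` along the curve. -/
def HasWindingNumber (γ : ℝ → ℂ) (p : ℂ) (n : ℤ) : Prop :=
  (∀ t ∈ Icc (0 : ℝ) 1, γ t ≠ p) ∧
  ∃ θ : ℝ → ℝ, ContinuousOn θ (Icc 0 1) ∧
    (∀ t ∈ Icc (0 : ℝ) 1, γ t - p = (‖γ t - p‖ : ℂ) * Complex.exp ((θ t : ℂ) * Complex.I)) ∧
    θ 1 - θ 0 = 2 * Real.pi * n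

/-- `γ`, defined on `[0, 1]`, is a counterclockwise parametrization of the boundary of `V` as a
simple closed curve: it is continuous, closed, injective up to the identification of the
endpoints, has `∂V` as its image, and winds once, in the positive sense, around every interior
point of `V`. -/
structure IsPositiveBoundaryParam (γ : ℝ → ℂ) (V : Set ℂ) : Prop where
  continuousOn : ContinuousOn γ (Icc 0 1)
  closed : γ 0 = γ 1
  injOn : InjOn γ (Ico 0 1)
  image_eq : γ '' Icc 0 1 = frontier V
  winding : ∀ p ∈ interior V, HasWindingNumber γ p 1

/-- `F` preserves the orientation of the boundary: it carries a counterclockwise parametrization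
of `∂V` to a counterclockwise parametrization of `∂W`. (When `F` restricts to a homeomorphism
between these two simple closed curves, the choice of the parametrization does not matter.) -/
def PreservesBoundaryOrientation (F : ℂ → ℂ) (V W : Set ℂ) : Prop :=
  ∃ γ : ℝ → ℂ, IsPositiveBoundaryParam γ V ∧ IsPositiveBoundaryParam (F ∘ γ) W

/-- `F = (u, v)` is a harmonic map on `V`: both coordinate functions `u` and `v` satisfy
`Δ u = Δ v = 0` in the interior of `V`. -/
def IsHarmonicMap (F : ℂ → ℂ) (V : Set ℂ) : Prop :=
  InnerProductSpace.HarmonicOnNhd (fun z => (F z).re) (interior V) ∧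
  InnerProductSpace.HarmonicOnNhd (fun z => (F z).im) (interior V)

end HarmonicBijection

/-! This is the Radó–Kneser–Choquet theorem. By the maximum principle applied to `l ∘ F` for linear
functionals `l`, the interior of `V` goes into the interior of `W`. The heart is that the
differential of `F` is invertible at every interior point `z`. Otherwise some `l ≠ 0` kills its
range, and the harmonic function `h = l ∘ F - l (F z)` has a critical zero at `z`. Near `z` its sign
then alternates in at least four sectors (`harmonicAt_exists_alternating_rays`). On the boundary,
however, `{h > 0}` and `{h < 0}` are connected: they correspond to the parts of `∂W` on the two
sides of a line through an interior point of the convex set `W`.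

Every component of `{h > 0}` inside `V` reaches the positive boundary part, so the positive sectors
can be joined by a curve of positivity, and likewise the negative ones. Two such curves would have
to cross in the plane (`false_of_joinedIn_rays`). Hence `h` vanishes identically, which the boundary
values forbid.

So `F` is a local homeomorphism inside `V`. Compactness of `V` makes it a covering over the interior
of `W`, which is simply connected, and therefore a bijection of the interiors; the boundary is
handled by hypothesis. -/

namespace HarmonicBijection

/-! ### Plane topology: a crossing lemma by continuous logarithms -/

open Complex Filter Topology

/-- If `b` and `b'` are joined in the complement of `K`, then `(z - b') / (z - b)` has a continuous
logarithm on `K`. -/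
theorem exists_continuousOn_log_div {K : Set ℂ} {b b' : ℂ} (h : JoinedIn Kᶜ b b') :
    ∃ l : ℂ → ℂ, ContinuousOn l K ∧ ∀ z ∈ K, exp (l z) = (z - b') / (z - b) := by
  classical
  obtain ⟨β, hβ⟩ := h
  have hne : ∀ t : unitInterval, ∀ z ∈ K, z - β t ≠ 0 := fun t z hz h0 =>
    hβ t (by rwa [← sub_eq_zero.1 h0])
  have hb : ∀ z ∈ K, z - b ≠ 0 := fun z hz => by simpa using hne 0 z hz
  -- At time `0` this homotopy is the constant `1`, with logarithm `0`; at time `1` it is the wanted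
  -- quotient. The covering homotopy property of `exp` carries the logarithm along.
  let H : C(unitInterval × K, {z : ℂ // z ≠ 0}) :=
    ⟨fun p => ⟨((p.2 : ℂ) - β p.1) / ((p.2 : ℂ) - b),
      div_ne_zero (hne _ _ p.2.2) (hb _ p.2.2)⟩, by
      refine Continuous.subtype_mk (Continuous.div ?_ ?_ fun p => hb _ p.2.2) _ <;> fun_prop⟩
  let L := isCoveringMap_exp.liftHomotopy H (ContinuousMap.const K (0 : ℂ)) (by
    intro a
    apply Subtype.ext
    simp [H, div_self (hb _ a.2)])
  have hL : ∀ p, exp (L p) = ((p.2 : ℂ) - β p.1) / ((p.2 : ℂ) - b) := fun p =>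
    congrArg Subtype.val (congrFun (isCoveringMap_exp.liftHomotopy_lifts H _ _) p)
  refine ⟨fun z => if hz : z ∈ K then L (1, ⟨z, hz⟩) else 0, ?_, fun z hz => ?_⟩
  · rw [continuousOn_iff_continuous_domRestrict]
    have : K.domRestrict (fun z => if hz : z ∈ K then L (1, ⟨z, hz⟩) else 0)
        = fun z : K => L (1, z) := by
      ext z; simp
    rw [this]
    fun_prop
  · simp [hz, hL]

/-- Two continuous logarithms of proportional functions on a connected set differ by a constant. -/
theorem sub_eq_sub_of_exp_eq {S : Set ℂ} (hS : IsPreconnected S) {f g : ℂ → ℂ} {c : ℂ}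
    (hf : ContinuousOn f S) (hg : ContinuousOn g S) (h : ∀ z ∈ S, exp (f z) = c * exp (g z))
    {x y : ℂ} (hx : x ∈ S) (hy : y ∈ S) : f x - f y = g x - g y := by
  have key : f x - g x = f y - g y := by
    refine isCoveringMap_exp.constOn_of_comp hS (hf.sub hg) ?_ hx hy
    intro a ha b hb
    apply Subtype.ext
    simp only [Pi.sub_apply, exp_sub, h a ha, h b hb]
    rw [mul_div_cancel_right₀ _ (exp_ne_zero _), mul_div_cancel_right₀ _ (exp_ne_zero _)]
  linear_combination key

theorem segment_union_isPreconnected (v w : ℂ) :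
    IsPreconnected (segment ℝ 0 v ∪ segment ℝ 0 w) :=
  IsPreconnected.union 0 (left_mem_segment ℝ 0 v) (left_mem_segment ℝ 0 w)
    (convex_segment _ _).isPreconnected (convex_segment _ _).isPreconnected

/-- For `ρ > 0` the number is real only if `sin φ = 0`; once `φ = 0` is excluded this forces `cos φ
= -1` and the value `s + ρ > 0`. -/
theorem sub_mul_exp_mem_slitPlane {s ρ φ : ℝ} (hρ : 0 ≤ ρ) (hsρ : 0 < s + ρ)
    (h1 : -(2 * Real.pi) < φ) (h2 : φ < 2 * Real.pi) (h0 : φ ≠ 0) :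
    (s : ℂ) - ρ * exp (φ * I) ∈ slitPlane := by
  have hre : ((s : ℂ) - ρ * exp (φ * I)).re = s - ρ * Real.cos φ := by
    simp [exp_ofReal_mul_I_re]
  have him : ((s : ℂ) - ρ * exp (φ * I)).im = - (ρ * Real.sin φ) := by
    simp [exp_ofReal_mul_I_im]
  rw [mem_slitPlane_iff, hre, him]
  by_cases hsin : Real.sin φ = 0
  · left
    have hcos : Real.cos φ ≠ 1 := fun hc => h0 ((Real.cos_eq_one_iff_of_lt_of_lt h1 h2).1 hc)
    rw [(Real.sin_eq_zero_iff_cos_eq.1 hsin).resolve_left hcos]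
    linarith
  · rcases hρ.eq_or_lt with h | h
    · left; simpa [← h] using hsρ
    · right; simp [h.ne', hsin]

theorem log_neg_mul_exp {r φ : ℝ} (hr : 0 < r) (h1 : 0 < φ) (h2 : φ ≤ 2 * Real.pi) :
    log (-(r * exp (φ * I))) = Real.log r + (φ - Real.pi) * I := by
  have : -(r * exp (φ * I)) = r * exp (((φ - Real.pi : ℝ) : ℂ) * I) := by
    rw [ofReal_sub, sub_mul, exp_sub, exp_pi_mul_I]; ring
  rw [this, log_ofReal_mul hr (exp_ne_zero _), log_exp]
  · push_cast; ring
  · simp; linarith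
  · simp; linarith

theorem neg_mul_exp_mem_slitPlane {r φ : ℝ} (hr : 0 < r) (h1 : -(2 * Real.pi) < φ)
    (h2 : φ < 2 * Real.pi) (h0 : φ ≠ 0) : -(r * exp (φ * I)) ∈ slitPlane := by
  simpa using sub_mul_exp_mem_slitPlane (s := 0) hr.le (by simpa using hr) h1 h2 h0

/-- A continuous function which is positive on the rays through `1` and `ω²` and negative on the
rays through `ω` and `ω⁻¹` near the origin, with `ω = exp (θ * I)`, cannot have both its positive
rays joined by a curve of positivity and its negative rays joined by a curve of negativity. -/
theorem false_of_joinedIn_rays {g : ℂ → ℝ} (hg : Continuous g) {θ r : ℝ} (hθ : 0 < θ)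
    (hθ' : θ ≤ Real.pi / 2) (hr : 0 < r)
    (p0 : ∀ s ∈ Ioc 0 r, 0 < g (s : ℝ))
    (p2 : ∀ s ∈ Ioc 0 r, 0 < g (s * exp ((2 * θ : ℝ) * I)))
    (n1 : ∀ s ∈ Ioc 0 r, g (s * exp (θ * I)) < 0)
    (n3 : ∀ s ∈ Ioc 0 r, g (s * exp ((-θ : ℝ) * I)) < 0)
    (hp : JoinedIn {z | 0 < g z} (r * exp ((2 * θ : ℝ) * I)) r)
    (hn : JoinedIn {z | g z < 0} (r * exp ((-θ : ℝ) * I)) (r * exp (θ * I))) : False := by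
  have hπ := Real.pi_pos
  obtain ⟨α, hα⟩ := hp
  have hrI : r ∈ Ioc 0 r := ⟨hr, le_rfl⟩
  have tend : ∀ c : ℂ, Tendsto (fun s : ℝ => g (s * c)) (𝓝[>] 0) (𝓝 (g 0)) := by
    intro c
    have : Continuous fun s : ℝ => g (s * c) := by fun_prop
    have := this.tendsto 0
    simp only [ofReal_zero, zero_mul] at this
    exact this.mono_left nhdsWithin_le_nhds
  have evI : ∀ᶠ s : ℝ in 𝓝[>] 0, s ∈ Ioc 0 r := Ioc_mem_nhdsGT hr
  have g0 : g 0 = 0 := by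
    apply le_antisymm
    · exact le_of_tendsto (tend _) (evI.mono fun s hs => (n1 s hs).le)
    · exact ge_of_tendsto (tend _) (evI.mono fun s hs => (p2 s hs).le)
  set R : Set ℂ := segment ℝ 0 (r : ℂ) ∪ segment ℝ 0 (r * exp ((2 * θ : ℝ) * I)) with hR
  have seg : ∀ c z : ℂ, z ∈ segment ℝ 0 (r * c) → ∃ ρ : ℝ, 0 ≤ ρ ∧ ρ ≤ r ∧ z = ρ * c := by
    intro c z hz
    rw [segment_eq_image] at hz
    obtain ⟨t, ht, rfl⟩ := hz
    refine ⟨t * r, mul_nonneg ht.1 hr.le, by nlinarith [ht.1, ht.2], ?_⟩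
    simp [mul_assoc]
  have Rcase : ∀ z ∈ R, (∃ ρ : ℝ, 0 ≤ ρ ∧ ρ ≤ r ∧ z = ρ) ∨
      (∃ ρ : ℝ, 0 ≤ ρ ∧ ρ ≤ r ∧ z = ρ * exp ((2 * θ : ℝ) * I)) := by
    rintro z (hz | hz)
    · left; simpa using seg 1 z (by simpa using hz)
    · right; exact seg _ z hz
  have Rnonneg : ∀ z ∈ R, 0 ≤ g z := by
    intro z hz
    rcases Rcase z hz with ⟨ρ, h0, h1, rfl⟩ | ⟨ρ, h0, h1, rfl⟩ <;>
    rcases h0.eq_or_lt with h | h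
    · simp [← h, g0]
    · exact (p0 ρ ⟨h, h1⟩).le
    · simp [← h, g0]
    · exact (p2 ρ ⟨h, h1⟩).le
  -- A closed loop: the positive curve, closed up through the origin by the two positive segments.
  -- The negative curve avoids it, although `s * exp (θ * I)` and `s * exp (-θ * I)` lie on
  -- different sides.
  set K : Set ℂ := range α ∪ R with hK
  have Knonneg : ∀ z ∈ K, 0 ≤ g z := by
    rintro z (⟨t, rfl⟩ | hz)
    · exact (hα t).le
    · exact Rnonneg z hz
  -- The points on the two negative rays are joined off `K`.
  have join1 : ∀ c : ℂ, (∀ s ∈ Ioc 0 r, g (s * c) < 0) → ∀ s ∈ Ioc 0 r,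
      JoinedIn {z | g z < 0} (s * c) (r * c) := by
    intro c hc s hs
    have hpc : IsPathConnected ((fun x : ℝ => (x : ℂ) * c) '' Ioc 0 r) :=
      ((convex_Ioc 0 r).isPathConnected ⟨r, hrI⟩).image (by fun_prop)
    refine (hpc.joinedIn _ ⟨s, hs, rfl⟩ _ ⟨r, hrI, rfl⟩).mono ?_
    rintro _ ⟨x, hx, rfl⟩
    exact hc x hx
  have joinK : ∀ s ∈ Ioc 0 r, JoinedIn Kᶜ (s * exp ((-θ : ℝ) * I)) (s * exp (θ * I)) := by
    intro s hs
    refine (((join1 _ n3 s hs).trans hn).trans (join1 _ n1 s hs).symm).mono ?_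
    intro z hz hzK
    exact absurd (Knonneg z hzK) (not_le.2 hz)
  -- Explicit branches.
  let w : ℂ := exp (θ * I)
  let w' : ℂ := exp ((-θ : ℝ) * I)
  have ww' : w * w' = 1 := by
    simp only [w, w', ← exp_add]; simp
  have wn : ‖w‖ = 1 := norm_exp_ofReal_mul_I _
  have wn' : ‖w'‖ = 1 := norm_exp_ofReal_mul_I _
  have e2 : exp ((2 * θ : ℝ) * I) = w * w := by
    simp only [w, ← exp_add]; congr 1; push_cast; ring
  have e3 : exp ((3 * θ : ℝ) * I) = w * w * w := by
    simp only [w, ← exp_add]; congr 1; push_cast; ring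
  -- Two branches of the logarithm of `(z - s * w) / (z - s * w')`: `L` on the segments, up to the
  -- constant factor `w * w`, and the principal branch `Q` on the curve.
  let L : ℝ → ℂ → ℂ := fun s z => log (s - z * w') - log (s - z * w)
  let Q : ℝ → ℂ → ℂ := fun s z => log ((z - s * w) / (z - s * w'))
  have slitR : ∀ s : ℝ, 0 < s → ∀ z ∈ R, (s : ℂ) - z * w' ∈ slitPlane ∧
      (s : ℂ) - z * w ∈ slitPlane := by
    intro s hs z hz
    rcases Rcase z hz with ⟨ρ, h0, h1, rfl⟩ | ⟨ρ, h0, h1, rfl⟩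
    · exact ⟨sub_mul_exp_mem_slitPlane h0 (by linarith) (by linarith) (by linarith) (by linarith),
        sub_mul_exp_mem_slitPlane h0 (by linarith) (by linarith) (by linarith) (by linarith)⟩
    · rw [e2]
      refine ⟨?_, ?_⟩
      · rw [mul_assoc, mul_assoc, ww', mul_one]
        exact sub_mul_exp_mem_slitPlane h0 (by linarith) (by linarith) (by linarith) (by linarith)
      · rw [mul_assoc, ← e3]
        exact sub_mul_exp_mem_slitPlane h0 (by linarith) (by linarith) (by linarith) (by linarith)
  have Lcont : ∀ s : ℝ, 0 < s → ContinuousOn (L s) R := by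
    intro s hs
    refine ContinuousOn.sub (ContinuousOn.clog (by fun_prop) fun z hz => (slitR s hs z hz).1)
      (ContinuousOn.clog (by fun_prop) fun z hz => (slitR s hs z hz).2)
  have Lexp : ∀ s : ℝ, 0 < s → ∀ z ∈ R,
      (z - s * w) / (z - s * w') = (w * w) * exp (L s z) := by
    intro s hs z hz
    obtain ⟨h1, h2⟩ := slitR s hs z hz
    have h1 := slitPlane_ne_zero h1
    have h2 := slitPlane_ne_zero h2
    simp only [L, exp_sub]
    rw [exp_log h1, exp_log h2]
    have e1 : z - s * w = - w * (s - z * w') := by linear_combination (-z) * ww'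
    have e2 : z - s * w' = - w' * (s - z * w) := by linear_combination (-z) * ww'
    have hw' : w' ≠ 0 := exp_ne_zero _
    rw [e1, e2]
    rw [div_eq_iff (mul_ne_zero (neg_ne_zero.2 hw') h2)]
    linear_combination (w * w * w') * (div_mul_cancel₀ (s - z * w') h2) + w * (s - z * w') * ww'
  -- The curve stays away from the origin.
  have hcomp : IsCompact (range α) := isCompact_range α.continuous
  have h0α : (0 : ℂ) ∉ range α := by
    rintro ⟨t, ht⟩
    have := hα t
    rw [ht] at this
    exact absurd this (by simp [g0])
  obtain ⟨d, hd, hdα⟩ : ∃ d > 0, ∀ z ∈ range α, d ≤ ‖z‖ := by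
    obtain ⟨ε, hε, hb⟩ := Metric.isOpen_iff.1 hcomp.isClosed.isOpen_compl 0 h0α
    refine ⟨ε, hε, fun z hz => not_lt.1 fun hlt => hb (mem_ball_zero_iff.2 hlt) hz⟩
  -- For `3 * s < d` the quotient is within distance `1` of `1`.
  have slitα : ∀ s : ℝ, 0 < s → s < d / 3 → ∀ z ∈ range α, z - s * w' ≠ 0 ∧
      (z - s * w) / (z - s * w') ∈ slitPlane := by
    intro s hs hsd z hz
    have hz' := hdα z hz
    have hsw : ‖(s : ℂ) * w'‖ = s := by simp [wn', abs_of_pos hs]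
    have hsw2 : ‖(s : ℂ) * w‖ = s := by simp [wn, abs_of_pos hs]
    have hden : 2 * s < ‖z - s * w'‖ := by
      have := norm_sub_norm_le z (s * w')
      rw [hsw] at this; linarith
    have hpos : 0 < ‖z - s * w'‖ := by linarith
    have hne : z - s * w' ≠ 0 := norm_pos_iff.1 hpos
    refine ⟨hne, ?_⟩
    have heq : (z - s * w) / (z - s * w') = 1 + (s * w' - s * w) / (z - s * w') := by
      field_simp; ring
    rw [heq]
    apply mem_slitPlane_of_norm_lt_one
    rw [norm_div, div_lt_one hpos]
    calc ‖(s : ℂ) * w' - s * w‖ ≤ ‖(s : ℂ) * w'‖ + ‖(s : ℂ) * w‖ := norm_sub_le _ _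
      _ = 2 * s := by rw [hsw, hsw2]; ring
      _ < _ := hden
  have hzr1 : (r : ℂ) ∈ R := Or.inl (right_mem_segment ℝ _ _)
  have hzr2 : (r * exp ((2 * θ : ℝ) * I) : ℂ) ∈ R := Or.inr (right_mem_segment ℝ _ _)
  -- A single logarithm exists on all of `K`, so its increments computed along the segments and
  -- along the curve agree.
  have key : ∀ᶠ s : ℝ in 𝓝[>] 0,
      L s r - L s (r * exp ((2 * θ : ℝ) * I)) = Q s r - Q s (r * exp ((2 * θ : ℝ) * I)) := by
    filter_upwards [evI, Ioo_mem_nhdsGT (show 0 < d / 3 by positivity)] with s hs hsd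
    obtain ⟨l, hl, hle⟩ := exists_continuousOn_log_div (joinK s hs)
    rw [← sub_eq_sub_of_exp_eq (segment_union_isPreconnected _ _)
      (hl.mono subset_union_right) (Lcont s hs.1)
      (fun z hz => (hle z (Or.inr hz)).trans (Lexp s hs.1 z hz)) hzr1 hzr2]
    refine sub_eq_sub_of_exp_eq (c := 1) (isPreconnected_range α.continuous)
      (hl.mono subset_union_left) ?_ ?_ ⟨1, α.target⟩ ⟨0, α.source⟩
    · refine ContinuousOn.clog (ContinuousOn.div (by fun_prop) (by fun_prop) ?_) ?_
      · exact fun z hz => (slitα s hs.1 hsd.2 z hz).1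
      · exact fun z hz => (slitα s hs.1 hsd.2 z hz).2
    · intro z hz
      rw [hle z (Or.inl hz), one_mul, exp_log (slitPlane_ne_zero (slitα s hs.1 hsd.2 z hz).2)]
  have tQ : ∀ z : ℂ, z ≠ 0 → Tendsto (fun s : ℝ => Q s z) (𝓝[>] 0) (𝓝 0) := by
    intro z hz
    have : ContinuousAt (fun s : ℝ => Q s z) 0 := by
      refine ContinuousAt.clog (ContinuousAt.div (by fun_prop) (by fun_prop) (by simpa)) ?_
      simp [hz]
    have := this.tendsto
    simp only [Q, ofReal_zero, zero_mul, sub_zero, div_self hz, log_one] at this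
    exact this.mono_left nhdsWithin_le_nhds
  have tL : ∀ z : ℂ, -(z * w') ∈ slitPlane → -(z * w) ∈ slitPlane →
      Tendsto (fun s : ℝ => L s z) (𝓝[>] 0) (𝓝 (log (-(z * w')) - log (-(z * w)))) := by
    intro z h1 h2
    have : ContinuousAt (fun s : ℝ => L s z) 0 := by
      refine ContinuousAt.sub (ContinuousAt.clog (by fun_prop) ?_)
        (ContinuousAt.clog (by fun_prop) ?_) <;> simpa
    have := this.tendsto
    simp only [L, ofReal_zero, zero_sub] at this
    exact this.mono_left nhdsWithin_le_nhds
  have hrne : (r : ℂ) ≠ 0 := by exact_mod_cast hr.ne'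
  have hA : (r * exp ((2 * θ : ℝ) * I) : ℂ) * w' = r * w := by
    rw [e2]; linear_combination r * w * ww'
  have hB : (r * exp ((2 * θ : ℝ) * I) : ℂ) * w = r * exp ((3 * θ : ℝ) * I) := by
    rw [e2, e3]; ring
  have hC : (r : ℂ) * w' = r * exp ((2 * Real.pi - θ : ℝ) * I) := by
    have : ((2 * Real.pi - θ : ℝ) : ℂ) * I = 2 * Real.pi * I + (-θ : ℝ) * I := by
      push_cast; ring
    rw [this, exp_add, exp_two_pi_mul_I, one_mul]
  have lim1 := (tL r
      (neg_mul_exp_mem_slitPlane hr (by linarith) (by linarith) (by linarith))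
      (neg_mul_exp_mem_slitPlane hr (by linarith) (by linarith) (by linarith))).sub
    (tL (r * exp ((2 * θ : ℝ) * I))
      (by rw [hA]; exact neg_mul_exp_mem_slitPlane hr (by linarith) (by linarith) (by linarith))
      (by rw [hB]; exact neg_mul_exp_mem_slitPlane hr (by linarith) (by linarith) (by linarith)))
  have lim2 := (tQ r hrne).sub (tQ (r * exp ((2 * θ : ℝ) * I)) (mul_ne_zero hrne (exp_ne_zero _)))
  have hlim := tendsto_nhds_unique_of_eventuallyEq lim1 lim2 key
  rw [hA, hB, hC, log_neg_mul_exp hr (by linarith) (by linarith),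
    log_neg_mul_exp hr (by linarith) (by linarith),
    log_neg_mul_exp hr (by linarith) (by linarith)] at hlim
  -- The terms in `θ` cancel, and the imaginary parts give `2π = 0`.
  have := congrArg Complex.im hlim
  simp at this
  linarith

end HarmonicBijection
-- Local behaviour of harmonic functions
namespace HarmonicBijection

open Complex Filter Topology InnerProductSpace

theorem harmonicAt_exists_analyticAt_re {h : ℂ → ℝ} {z : ℂ} (hh : HarmonicAt h z) :
    ∃ f : ℂ → ℂ, AnalyticAt ℂ f z ∧ ∀ᶠ w in 𝓝 z, (f w).re = h w := by
  obtain ⟨ε, hε, hb⟩ := Metric.eventually_nhds_iff_ball.1 hh.eventually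
  obtain ⟨f, hf, he⟩ := HarmonicOnNhd.exists_analyticOnNhd_ball_re_eq (f := h) hb
  exact ⟨f, hf z (Metric.mem_ball_self hε),
    Filter.mem_of_superset (Metric.ball_mem_nhds z hε) he⟩

theorem harmonicOnNhd_eqOn_const {h : ℂ → ℝ} {U : Set ℂ} (hU : IsPreconnected U)
    (hh : HarmonicOnNhd h U) {z : ℂ} (hz : z ∈ U) {c : ℝ} (hc : ∀ᶠ w in 𝓝 z, h w = c) :
    ∀ w ∈ U, h w = c :=
  AnalyticOnNhd.eqOn_of_preconnected_of_eventuallyEq (𝕜 := ℝ) (g := fun _ => c)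
    (fun w hw => HarmonicAt.analyticAt (hh w hw)) analyticOnNhd_const hU hz hc

/-- The strong maximum principle for harmonic functions. -/
theorem harmonicOnNhd_eqOn_of_isLocalMax {h : ℂ → ℝ} {U : Set ℂ} (hU : IsPreconnected U)
    (hh : HarmonicOnNhd h U) {z : ℂ} (hz : z ∈ U) (hmax : IsLocalMax h z) :
    ∀ w ∈ U, h w = h z := by
  obtain ⟨f, hf, he⟩ := harmonicAt_exists_analyticAt_re (hh z hz)
  refine harmonicOnNhd_eqOn_const hU hh hz ?_
  -- Since `‖exp f‖ = exp (re f)`, the maximum modulus principle applies to `exp ∘ f`.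
  have hmax' : IsLocalMax (norm ∘ fun w => exp (f w)) z := by
    filter_upwards [hmax, he] with w h1 h2
    simp only [Function.comp, norm_exp, h2, he.self_of_nhds]
    exact Real.exp_le_exp.2 h1
  have hd : ∀ᶠ w in 𝓝 z, DifferentiableAt ℂ (fun w => exp (f w)) w := by
    filter_upwards [hf.eventually_analyticAt] with w hw
    exact hw.differentiableAt.cexp
  filter_upwards [eventually_eq_of_isLocalMax_norm hd hmax', he] with w h1 h2
  have := congrArg norm h1
  simp only [norm_exp, Real.exp_eq_exp] at this
  rw [← h2, this, he.self_of_nhds]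

/-- Near a critical zero a non-constant harmonic function has at least four sectors in which its
signs alternate. -/
theorem harmonicAt_exists_alternating_rays {h : ℂ → ℝ} {z : ℂ} (hh : HarmonicAt h z)
    (h0 : h z = 0) (hd : fderiv ℝ h z = 0) (hne : ¬ ∀ᶠ w in 𝓝 z, h w = 0) :
    ∃ e : ℂ, e ≠ 0 ∧ ∃ θ : ℝ, 0 < θ ∧ θ ≤ Real.pi / 2 ∧ ∀ᶠ s : ℝ in 𝓝[>] 0,
      0 < h (z + e * s) ∧ 0 < h (z + e * (s * exp ((2 * θ : ℝ) * I))) ∧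
      h (z + e * (s * exp (θ * I))) < 0 ∧ h (z + e * (s * exp ((-θ : ℝ) * I))) < 0 := by
  obtain ⟨f₀, hf₀, he₀⟩ := harmonicAt_exists_analyticAt_re hh
  obtain ⟨f, hf, he, hfz⟩ : ∃ f : ℂ → ℂ, AnalyticAt ℂ f z ∧ (∀ᶠ w in 𝓝 z, (f w).re = h w) ∧
      f z = 0 := by
    refine ⟨fun w => f₀ w - f₀ z, hf₀.sub analyticAt_const, ?_, sub_self _⟩
    filter_upwards [he₀] with w hw
    simp [hw, he₀.self_of_nhds, h0]
  have hf0 : ¬ ∀ᶠ w in 𝓝 z, f w = 0 := by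
    refine fun hev => hne ?_
    filter_upwards [hev, he] with w h1 h2
    rw [← h2, h1, zero_re]
  obtain ⟨n, g, hg, hg0, hfg⟩ := hf.exists_eventuallyEq_pow_smul_nonzero_iff.2 hf0
  -- The real parts of `f' z` and `f' z * I` both vanish, so `f` has a zero of order `n ≥ 2`.
  have hderiv : deriv f z = 0 := by
    have h1 : HasFDerivAt h (0 : ℂ →L[ℝ] ℝ) z := by
      rw [← hd]; exact (hh.1.differentiableAt two_ne_zero).hasFDerivAt
    have h2 : HasFDerivAt (fun w => (f w).re) _ z :=
      reCLM.hasFDerivAt.comp z (hf.differentiableAt.hasDerivAt.hasFDerivAt.restrictScalars ℝ)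
    have h3 := (h1.congr_of_eventuallyEq he).unique h2
    have e1 := congrArg (fun φ : ℂ →L[ℝ] ℝ => φ 1) h3
    have e2 := congrArg (fun φ : ℂ →L[ℝ] ℝ => φ I) h3
    simp at e1 e2
    exact Complex.ext (by simpa using e1.symm) (by simpa using e2)
  have hn0 : n ≠ 0 := by
    rintro rfl
    have := hfg.self_of_nhds
    simp [hfz, hg0.symm] at this
  have hn1 : n ≠ 1 := by
    rintro rfl
    have h1 : HasDerivAt (fun w => (w - z) ^ 1 • g w) (g z) z := by
      have := ((hasDerivAt_id z).sub_const z).mul hg.differentiableAt.hasDerivAt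
      have e1 : (fun w => (w - z) ^ 1 • g w) = (fun w => id w - z) * g := by
        ext w; simp
      rw [e1]
      simpa using this
    exact hg0 ((h1.congr_of_eventuallyEq hfg).deriv.symm.trans hderiv)
  have hn : (2 : ℝ) ≤ n := by exact_mod_cast (by omega : 2 ≤ n)
  have hnpos : (0 : ℝ) < n := by linarith
  have hnC : (n : ℂ) ≠ 0 := by exact_mod_cast hn0
  -- With this unit, `f (z + e * ζ)` has leading term `ζ ^ n`, so the rays at angles `k * π / n`
  -- carry the sign of `cos (k * π)`.
  obtain ⟨e, hepow⟩ : ∃ e : ℂ, e ^ n = (g z)⁻¹ := IsAlgClosed.exists_pow_nat_eq _ (by omega)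
  have hepow' : e ^ n * g z = 1 := by rw [hepow, inv_mul_cancel₀ hg0]
  have heg : e ≠ 0 := by
    rintro rfl
    rw [zero_pow hn0, zero_mul] at hepow'
    exact zero_ne_one hepow'
  -- The sign along a ray is that of the real part of the `n`-th power of the direction.
  have ray : ∀ d : ℂ, ∀ᶠ s : ℝ in 𝓝[>] 0, (d ^ n).re ≠ 0 →
      0 < (d ^ n).re * h (z + e * (s * d)) := by
    intro d
    have hc : Tendsto (fun s : ℝ => z + e * (s * d)) (𝓝[>] 0) (𝓝 z) := by
      have : Continuous fun s : ℝ => z + e * (s * d) := by fun_prop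
      have := this.tendsto 0
      simp only [ofReal_zero, zero_mul, mul_zero, add_zero] at this
      exact this.mono_left nhdsWithin_le_nhds
    have hlim : Tendsto (fun s : ℝ => (e ^ n * d ^ n * g (z + e * (s * d))).re) (𝓝[>] 0)
        (𝓝 (d ^ n).re) := by
      have := (continuous_re.tendsto _).comp
        ((hg.continuousAt.tendsto.comp hc).const_mul (e ^ n * d ^ n))
      rwa [mul_right_comm, hepow', one_mul] at this
    by_cases hre : (d ^ n).re = 0
    · simp [hre]
    have hpos : ∀ᶠ s : ℝ in 𝓝[>] 0,
        0 < (d ^ n).re * (e ^ n * d ^ n * g (z + e * (s * d))).re :=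
      (hlim.const_mul _).eventually (lt_mem_nhds (mul_self_pos.2 hre))
    filter_upwards [hpos, hc.eventually he, hc.eventually hfg, self_mem_nhdsWithin]
      with s h1 h2 h3 hs _
    have hs : 0 < s := hs
    rw [← h2, h3, smul_eq_mul]
    have : (z + e * (s * d) - z) ^ n * g (z + e * (s * d))
        = ((s ^ n : ℝ) : ℂ) * (e ^ n * d ^ n * g (z + e * (s * d))) := by
      push_cast; ring
    rw [this, re_ofReal_mul]
    have := mul_pos (pow_pos hs n) h1
    linarith
  have hω : ∀ k : ℝ, (exp ((k * (Real.pi / n) : ℝ) * I) ^ n).re = Real.cos (k * Real.pi) := by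
    intro k
    rw [← exp_nat_mul]
    have : (n : ℂ) * (((k * (Real.pi / n) : ℝ) : ℂ) * I) = ((k * Real.pi : ℝ) : ℂ) * I := by
      push_cast; field_simp
    rw [this, exp_ofReal_mul_I_re]
  refine ⟨e, heg, Real.pi / n, by positivity, ?_, ?_⟩
  · exact div_le_div_of_nonneg_left Real.pi_pos.le (by norm_num) hn
  have c1 := hω 1
  have c2 := hω 2
  have c3 := hω (-1)
  simp only [one_mul, neg_mul, Real.cos_neg, Real.cos_pi, Real.cos_two_pi] at c1 c2 c3
  filter_upwards [ray 1, ray (exp ((Real.pi / n : ℝ) * I)),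
    ray (exp ((2 * (Real.pi / n) : ℝ) * I)), ray (exp ((-(Real.pi / n) : ℝ) * I))]
    with s h0 h1 h2 h3
  rw [c1] at h1
  rw [c2] at h2
  rw [c3] at h3
  simp only [one_pow, one_re, ne_eq, one_ne_zero, not_false_eq_true, one_mul, mul_one,
    forall_const] at h0
  refine ⟨h0, by simpa using h2, ?_, ?_⟩
  · linarith [h1 (by norm_num)]
  · linarith [h3 (by norm_num)]

end HarmonicBijection
-- Sign components and the absence of critical zeros
namespace HarmonicBijection

open Complex Filter Topology InnerProductSpace Pointwise

theorem mem_interior_or_mem_frontier {X : Type*} [TopologicalSpace X] {V : Set X} (hV : IsClosed V)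
    {x : X} (hx : x ∈ V) : x ∈ interior V ∨ x ∈ frontier V := by
  rw [hV.frontier_eq]
  by_cases h : x ∈ interior V
  exacts [Or.inl h, Or.inr ⟨hx, h⟩]

/-- A component of the positivity set of a harmonic function reaches the boundary. -/
theorem exists_frontier_mem_closure_component {V : Set ℂ} (hV : IsCompact V)
    (hU : IsPreconnected (interior V)) {h : ℂ → ℝ} (hcont : ContinuousOn h V)
    (hharm : HarmonicOnNhd h (interior V)) {z a : ℂ} (hz : z ∈ interior V) (hz0 : h z ≤ 0)
    (ha : a ∈ interior V) (ha0 : 0 < h a) :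
    ∃ x ∈ frontier V, 0 < h x ∧ x ∈ closure (connectedComponentIn {w ∈ interior V | 0 < h w} a) := by
  set P := {w ∈ interior V | 0 < h w}
  set C := connectedComponentIn P a
  have haP : a ∈ P := ⟨ha, ha0⟩
  have hPopen : IsOpen P :=
    (hcont.mono interior_subset).isOpen_inter_preimage isOpen_interior isOpen_Ioi
  have hCV : closure C ⊆ V := closure_minimal
    (((connectedComponentIn_subset _ _).trans (sep_subset _ _)).trans interior_subset) hV.isClosed
  have haC : a ∈ C := mem_connectedComponentIn haP
  obtain ⟨x, hx, hmax⟩ := (hV.of_isClosed_subset isClosed_closure hCV).exists_isMaxOn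
    ⟨a, subset_closure haC⟩ (hcont.mono hCV)
  have hx0 : 0 < h x := ha0.trans_le (hmax (subset_closure haC))
  rcases mem_interior_or_mem_frontier hV.isClosed (hCV hx) with hxU | hxF
  · exfalso
    have hxP : x ∈ P := ⟨hxU, hx0⟩
    -- An interior maximum point would belong to the open component itself, hence be a local
    -- maximum; then `h` would be a positive constant, contrary to `h z ≤ 0`.
    have hCx : insert x C ⊆ C := by
      refine IsPreconnected.subset_connectedComponentIn ?_ (mem_insert_of_mem _ haC)
        (insert_subset hxP (connectedComponentIn_subset _ _))
      exact isPreconnected_connectedComponentIn.subset_closure (subset_insert _ _)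
        (insert_subset hx subset_closure)
    have hxC : x ∈ C := hCx (mem_insert _ _)
    have hCnhds : C ∈ 𝓝 x := (hPopen.connectedComponentIn).mem_nhds hxC
    have hloc : IsLocalMax h x := by
      filter_upwards [hCnhds] with y hy using hmax (subset_closure hy)
    have := harmonicOnNhd_eqOn_of_isLocalMax hU hharm hxU hloc z hz
    linarith
  · exact ⟨x, hxF, hx0, hx⟩

/-- If the positive part of the boundary is connected, two points of positivity of a harmonic
function can be joined by a curve on which a given continuous extension is positive. -/
theorem joinedIn_pos_of_isPreconnected_frontier {V : Set ℂ} (hV : IsCompact V)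
    (hU : IsPreconnected (interior V)) {h g : ℂ → ℝ} (hg : Continuous g) (hgh : EqOn g h V)
    (hharm : HarmonicOnNhd h (interior V)) (hfr : IsPreconnected {x ∈ frontier V | 0 < h x})
    {z a b : ℂ} (hz : z ∈ interior V) (hz0 : h z ≤ 0)
    (ha : a ∈ interior V) (ha0 : 0 < h a) (hb : b ∈ interior V) (hb0 : 0 < h b) :
    JoinedIn {w | 0 < g w} a b := by
  have hcont : ContinuousOn h V := hg.continuousOn.congr hgh.symm
  set P := {w ∈ interior V | 0 < h w}
  set A := {x ∈ frontier V | 0 < h x}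
  set O := {w | 0 < g w}
  -- The extension `g` makes the positivity set open in the plane, so connectedness through boundary
  -- points yields a path; the path may leave `V`.
  have hO : IsOpen O := isOpen_lt continuous_const hg
  have hPO : P ⊆ O := fun w hw => by
    have := hgh (interior_subset hw.1)
    simpa [O, this] using hw.2
  have hAO : A ⊆ O := fun w hw => by
    have := hgh (hV.isClosed.frontier_subset hw.1)
    simpa [O, this] using hw.2
  have aux : ∀ c ∈ P, IsPreconnected (closure (connectedComponentIn P c) ∩ O ∪ A) ∧
      c ∈ closure (connectedComponentIn P c) ∩ O ∪ A ∧ A.Nonempty := by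
    intro c hc
    obtain ⟨x, hxF, hx0, hx⟩ := exists_frontier_mem_closure_component hV hU hcont hharm hz hz0
      hc.1 hc.2
    have hT : IsPreconnected (closure (connectedComponentIn P c) ∩ O) :=
      isPreconnected_connectedComponentIn.subset_closure
        (subset_inter subset_closure ((connectedComponentIn_subset _ _).trans hPO))
        inter_subset_left
    exact ⟨hT.union x ⟨hx, hAO ⟨hxF, hx0⟩⟩ ⟨hxF, hx0⟩ hfr,
      Or.inl ⟨subset_closure (mem_connectedComponentIn hc), hPO hc⟩, ⟨x, hxF, hx0⟩⟩
  obtain ⟨ca, haS, ⟨x, hx⟩⟩ := aux a ⟨ha, ha0⟩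
  obtain ⟨cb, hbS, -⟩ := aux b ⟨hb, hb0⟩
  have hsub := (ca.union x (Or.inr hx) (Or.inr hx) cb).subset_connectedComponentIn (F := O)
    (Or.inl haS) (union_subset (union_subset inter_subset_right hAO)
      (union_subset inter_subset_right hAO))
  have hconn : IsConnected (connectedComponentIn O a) :=
    isConnected_connectedComponentIn_iff.2 (hPO ⟨ha, ha0⟩)
  have hpath := (hO.connectedComponentIn.isConnected_iff_isPathConnected).1 hconn
  exact (hpath.joinedIn a (hsub (Or.inl haS)) b (hsub (Or.inr hbS))).mono
    (connectedComponentIn_subset _ _)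

/-- A harmonic function whose boundary values change sign only twice has no critical zero, unless
it vanishes identically. -/
theorem eqOn_zero_of_critical_zero {V : Set ℂ} (hV : IsCompact V)
    (hU : IsPreconnected (interior V)) {h : ℂ → ℝ} (hcont : ContinuousOn h V)
    (hharm : HarmonicOnNhd h (interior V)) (hpos : IsPreconnected {x ∈ frontier V | 0 < h x})
    (hneg : IsPreconnected {x ∈ frontier V | h x < 0}) {z : ℂ} (hz : z ∈ interior V)
    (hz0 : h z = 0) (hd : fderiv ℝ h z = 0) : ∀ w ∈ interior V, h w = 0 := by
  by_contra hcon
  have hne : ¬ ∀ᶠ w in 𝓝 z, h w = 0 := fun hev =>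
    hcon (harmonicOnNhd_eqOn_const hU hharm hz hev)
  obtain ⟨e, he, θ, hθ, hθ', hev⟩ :=
    harmonicAt_exists_alternating_rays (hharm z hz) hz0 hd hne
  obtain ⟨G, hG⟩ := ContinuousMap.exists_restrict_eq hV.isClosed
    ⟨V.domRestrict h, continuousOn_iff_continuous_domRestrict.1 hcont⟩
  have hGh : EqOn G h V := fun x hx => congrArg (fun f : C(V, ℝ) => f ⟨x, hx⟩) hG
  have hnhds : ∀ c : ℂ, ∀ᶠ s : ℝ in 𝓝[>] 0, z + e * (s * c) ∈ interior V := by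
    intro c
    have : Continuous fun s : ℝ => z + e * (s * c) := by fun_prop
    have := this.tendsto 0
    simp only [ofReal_zero, zero_mul, mul_zero, add_zero] at this
    exact (this.mono_left nhdsWithin_le_nhds).eventually (isOpen_interior.mem_nhds hz)
  obtain ⟨r, hr, hI⟩ := mem_nhdsGT_iff_exists_Ioc_subset.1 (((((hev.and (hnhds 1)).and
    (hnhds (exp ((2 * θ : ℝ) * I)))).and (hnhds (exp (θ * I)))).and
    (hnhds (exp ((-θ : ℝ) * I)))))
  have hr : 0 < r := hr
  have key : ∀ s ∈ Ioc 0 r, _ := fun s hs => hI hs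
  simp only [mem_ofPred_eq, mul_one] at key
  have hrI : r ∈ Ioc 0 r := ⟨hr, le_rfl⟩
  have eqG : ∀ w ∈ interior V, G w = h w := fun w hw => hGh (interior_subset hw)
  obtain ⟨⟨⟨⟨⟨q0, q2, q1, q3⟩, u0⟩, u2⟩, u1⟩, u3⟩ := key r hrI
  have jp := joinedIn_pos_of_isPreconnected_frontier hV hU G.continuous hGh hharm hpos hz hz0.le
    u2 q2 u0 q0
  have jn := joinedIn_pos_of_isPreconnected_frontier (h := -h) (g := fun w => -G w) hV hU
    G.continuous.neg (fun x hx => by simp [hGh hx]) hharm.neg (by simpa using hneg) hz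
    (by simp [hz0]) u3 (by simpa using q3) u1 (by simpa using q1)
  -- Transport the curves to the coordinate centred at `z` with unit `e`.
  have pull : ∀ {S : Set ℂ} {a b : ℂ}, JoinedIn S (z + e * a) (z + e * b) →
      JoinedIn ((fun w => z + e * w) ⁻¹' S) a b := by
    intro S a b hj
    have := hj.map_continuousOn (f := fun w => e⁻¹ * (w - z)) (by fun_prop)
    have e1 : ∀ w, e⁻¹ * (z + e * w - z) = w := fun w => by field_simp; ring
    rw [e1, e1] at this
    refine this.mono ?_
    rintro _ ⟨w, hw, rfl⟩
    have : z + e * (e⁻¹ * (w - z)) = w := by field_simp; ring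
    simpa [this] using hw
  refine false_of_joinedIn_rays (g := fun w => G (z + e * w)) (by fun_prop) hθ hθ' hr
    ?_ ?_ ?_ ?_ (pull jp) ((pull jn).mono fun w hw => by simpa using hw) <;>
  intro s hs <;> obtain ⟨⟨⟨⟨⟨p0, p2, p1, p3⟩, v0⟩, v2⟩, v1⟩, v3⟩ := key s hs
  · simpa only [eqG _ v0] using p0
  · simpa only [eqG _ v2] using p2
  · simpa only [eqG _ v1] using p1
  · simpa only [eqG _ v3] using p3

/-! ### Half-plane sections of a convex boundary -/

/-- The part of the boundary of a convex body which lies strictly on one side of a line through an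
interior point is connected and non-empty. -/
theorem isConnected_frontier_halfPlane {E : Type*} [NormedAddCommGroup E] [NormedSpace ℝ E]
    {W : Set E} (hconv : Convex ℝ W) (hb : Bornology.IsBounded W) {w : E} (hw : w ∈ interior W)
    (l : E →L[ℝ] ℝ) (hl : l ≠ 0) : IsConnected {y ∈ frontier W | l w < l y} := by
  set S : Set E := -w +ᵥ W
  have hS : S ∈ 𝓝 0 := by
    rw [← mem_interior_iff_mem_nhds, interior_vadd, mem_vadd_set_iff_neg_vadd_mem]
    simpa using hw
  have hSc : Convex ℝ S := hconv.vadd _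
  have hSb : Bornology.IsVonNBounded ℝ S :=
    NormedSpace.isVonNBounded_of_isBounded _ (hb.vadd _)
  have hfr : ∀ y, y ∈ frontier W ↔ gauge S (y - w) = 1 := by
    intro y
    rw [gauge_eq_one_iff_mem_frontier hSc hS]
    simp only [frontier, S, closure_vadd, interior_vadd, Set.mem_sdiff,
      mem_vadd_set_iff_neg_vadd_mem, neg_neg, vadd_eq_add, add_sub_cancel]
  have hpos : ∀ d, 0 < l d → 0 < gauge S d := fun d hd =>
    (gauge_pos (absorbent_nhds_zero hS) hSb).2 fun h0 => by simp [h0] at hd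
  -- Radial projection from `w`, by means of the gauge, maps the convex open half-space `{0 < l d}`
  -- onto this part of the boundary.
  have himg : {y ∈ frontier W | l w < l y} =
      (fun d => w + (gauge S d)⁻¹ • d) '' {d | 0 < l d} := by
    ext y
    constructor
    · rintro ⟨hy, hly⟩
      refine ⟨y - w, by simpa using hly, ?_⟩
      simp [(hfr y).1 hy]
    · rintro ⟨d, hd, rfl⟩
      have hg := hpos d hd
      refine ⟨(hfr _).2 ?_, ?_⟩
      · rw [add_sub_cancel_left, gauge_smul_of_nonneg (inv_nonneg.2 hg.le), smul_eq_mul,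
          inv_mul_cancel₀ hg.ne']
      · simp only [map_add, map_smul, smul_eq_mul]
        have := mul_pos (inv_pos.2 hg) hd
        linarith
  rw [himg]
  have hconvl : Convex ℝ {d | 0 < l d} := (convex_Ioi (0 : ℝ)).linear_preimage l.toLinearMap
  refine IsConnected.image ⟨?_, hconvl.isPreconnected⟩ _ ?_
  · obtain ⟨d, hd⟩ : ∃ d, l d ≠ 0 := by
      by_contra! h
      exact hl (by ext d; simpa using h d)
    rcases hd.lt_or_gt with h | h
    · exact ⟨-d, by simpa using h⟩
    · exact ⟨d, h⟩
  · refine continuousOn_const.add (ContinuousOn.smul (ContinuousOn.inv₀ ?_ ?_) continuousOn_id)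
    · exact (continuous_gauge hSc hS).continuousOn
    · exact fun d hd => (hpos d hd).ne'

end HarmonicBijection
-- The harmonic map: interior images and the differential
namespace HarmonicBijection

open Complex Filter Topology InnerProductSpace

theorem harmonicOnNhd_clm_comp {F : ℂ → ℂ} {V : Set ℂ} (hF : IsHarmonicMap F V) (l : ℂ →L[ℝ] ℝ) :
    HarmonicOnNhd (fun z => l (F z)) (interior V) := by
  have h := (hF.1.const_smul (c := l 1)).add (hF.2.const_smul (c := l I))
  have e : (fun z => l (F z)) =
      l 1 • (fun z => (F z).re) + l I • fun z => (F z).im := by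
    ext z
    have : F z = (F z).re • (1 : ℂ) + (F z).im • I := by simp
    conv_lhs => rw [this, map_add, map_smul, map_smul]
    simp [mul_comm]
  rwa [e]

/-- Preimages of connected subsets of `B` under a homeomorphism `A → B` are connected. -/
theorem RestrictsToHomeo.isPreconnected_sep {F : ℂ → ℂ} {A B : Set ℂ} (hF : RestrictsToHomeo F A B)
    {p : ℂ → Prop} (hp : IsPreconnected {y ∈ B | p y}) : IsPreconnected {x ∈ A | p (F x)} := by
  obtain ⟨φ, hφ⟩ := hF
  have h1 : IsPreconnected {y : B | p y} := by
    rw [← Topology.IsInducing.subtypeVal.isPreconnected_image]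
    convert! hp using 1
    ext y
    simp [and_comm]
  have h2 : (fun y : B => (φ.symm y : ℂ)) '' {y : B | p y} = {x ∈ A | p (F x)} := by
    ext x
    constructor
    · rintro ⟨y, hy, rfl⟩
      refine ⟨(φ.symm y).2, ?_⟩
      rw [← hφ, φ.apply_symm_apply]
      exact hy
    · rintro ⟨hx, hpx⟩
      refine ⟨φ ⟨x, hx⟩, ?_, by simp⟩
      simpa [hφ] using hpx
  rw [← h2]
  exact h1.image _ (by fun_prop)

theorem RestrictsToHomeo.bijOn {F : ℂ → ℂ} {A B : Set ℂ} (hF : RestrictsToHomeo F A B) :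
    BijOn F A B := by
  obtain ⟨φ, hφ⟩ := hF
  refine ⟨fun x hx => ?_, fun x hx y hy hxy => ?_, fun y hy => ?_⟩
  · rw [← hφ ⟨x, hx⟩]; exact (φ _).2
  · have : φ ⟨x, hx⟩ = φ ⟨y, hy⟩ := Subtype.ext (by rw [hφ, hφ]; exact hxy)
    exact congrArg Subtype.val (φ.injective this)
  · exact ⟨φ.symm ⟨y, hy⟩, (φ.symm _).2, by rw [← hφ, φ.apply_symm_apply]⟩

/-- A linear functional is not constant on the image of the interior. -/
theorem exists_clm_apply_ne {V W : Set ℂ} (hVcl : closure (interior V) = V)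
    (hVc : IsClosed V) (hconv : Convex ℝ W) (hWb : Bornology.IsBounded W)
    (hWne : (interior W).Nonempty) {F : ℂ → ℂ} (hcont : ContinuousOn F V)
    (hF : RestrictsToHomeo F (frontier V) (frontier W)) {l : ℂ →L[ℝ] ℝ} (hl : l ≠ 0) (c : ℝ) :
    ∃ z ∈ interior V, l (F z) ≠ c := by
  by_contra! hcon
  obtain ⟨w, hw⟩ := hWne
  have hV : ∀ x ∈ V, l (F x) = c := by
    have : EqOn (fun x => l (F x)) (fun _ => c) (closure (interior V)) :=
      EqOn.of_subset_closure hcon (l.continuous.comp_continuousOn (hcont.mono hVcl.subset))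
        continuousOn_const subset_closure subset_rfl
    rwa [hVcl] at this
  have hW : ∀ y ∈ frontier W, l y = c := by
    intro y hy
    obtain ⟨x, hx, rfl⟩ := hF.bijOn.surjOn hy
    exact hV x (hVc.frontier_subset hx)
  -- The boundary of `W` has points strictly on both sides of the line through `w`, so `l` is not
  -- constant there.
  obtain ⟨y, hy, h1⟩ := (isConnected_frontier_halfPlane hconv hWb hw l hl).nonempty
  obtain ⟨y', hy', h2⟩ :=
    (isConnected_frontier_halfPlane hconv hWb hw (-l) (neg_ne_zero.2 hl)).nonempty
  have h2 : -l w < -l y' := h2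
  rw [hW y hy] at h1
  rw [hW y' hy'] at h2
  linarith

/-- By the maximum principle, interior points are mapped into the interior of the convex set. -/
theorem mapsTo_interior {V W : Set ℂ} (hV : IsSimplyConnectedDomain V)
    (hW : IsSimplyConnectedDomain W) (hconv : Convex ℝ W) {F : ℂ → ℂ}
    (hharm : IsHarmonicMap F V) (hcont : ContinuousOn F V)
    (hF : RestrictsToHomeo F (frontier V) (frontier W)) :
    MapsTo F (interior V) (interior W) := by
  intro z hz
  by_contra hzW
  obtain ⟨l, hl⟩ := geometric_hahn_banach_open_point hconv.interior isOpen_interior hzW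
  have hU : IsPreconnected (interior V) :=
    hV.simplyConnected.isPathConnected.isConnected.isPreconnected
  obtain ⟨w, hw⟩ := hW.simplyConnected.nonempty
  have hl0 : l ≠ 0 := by
    rintro rfl
    simpa using hl w hw
  have hlW : ∀ y ∈ W, l y ≤ l (F z) := by
    intro y hy
    rw [← hW.closure_interior] at hy
    exact closure_minimal (fun y hy => (hl y hy).le)
      (isClosed_le l.continuous continuous_const) hy
  have hh := harmonicOnNhd_clm_comp hharm l
  have hconst : ∃ c, ∀ x ∈ interior V, l (F x) = c := by
    obtain ⟨x, hx, hmax⟩ := hV.isCompact.exists_isMaxOn ⟨z, interior_subset hz⟩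
      (l.continuous.comp_continuousOn hcont)
    have main : ∀ x ∈ interior V, (∀ y ∈ V, l (F y) ≤ l (F x)) →
        ∀ y ∈ interior V, l (F y) = l (F x) := fun x hx hm =>
      harmonicOnNhd_eqOn_of_isLocalMax hU hh hx
        (Filter.mem_of_superset (isOpen_interior.mem_nhds hx) fun y hy => hm y (interior_subset hy))
    rcases mem_interior_or_mem_frontier hV.isCompact.isClosed hx with hxU | hxF
    · exact ⟨_, main x hxU hmax⟩
    -- The maximum over `V` is attained at a boundary point, whose image lies in `W`, so it is at
    -- most `l (F z)`; thus `z` itself is a maximum point.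
    · refine ⟨_, main z hz fun y hy => (hmax hy).trans ?_⟩
      exact hlW _ (hW.isCompact.isClosed.frontier_subset (hF.bijOn.mapsTo hxF))
  obtain ⟨c, hc⟩ := hconst
  obtain ⟨x, hx, hne⟩ := exists_clm_apply_ne hV.closure_interior hV.isCompact.isClosed hconv
    hW.isCompact.isBounded ⟨w, hw⟩ hcont hF hl0 c
  exact hne (hc x hx)

/-- The differential of the harmonic map is onto at every interior point. -/
theorem range_fderiv_eq_top {V W : Set ℂ} (hV : IsSimplyConnectedDomain V)
    (hW : IsSimplyConnectedDomain W) (hconv : Convex ℝ W) {F : ℂ → ℂ}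
    (hharm : IsHarmonicMap F V) (hcont : ContinuousOn F V)
    (hF : RestrictsToHomeo F (frontier V) (frontier W)) {z : ℂ} (hz : z ∈ interior V)
    (hd : DifferentiableAt ℝ F z) : (fderiv ℝ F z).range = ⊤ := by
  by_contra hcon
  obtain ⟨f, hf0, hf⟩ := Submodule.exists_le_ker_of_lt_top _ (lt_top_iff_ne_top.2 hcon)
  set l : ℂ →L[ℝ] ℝ := LinearMap.toContinuousLinearMap f with hl
  have hl0 : l ≠ 0 := fun h => hf0 (LinearMap.ext fun x => DFunLike.congr_fun h x)
  have hU : IsPreconnected (interior V) :=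
    hV.simplyConnected.isPathConnected.isConnected.isPreconnected
  have hzW := mapsTo_interior hV hW hconv hharm hcont hF hz
  have hder : fderiv ℝ (fun w => l (F w) - l (F z)) z = 0 := by
    rw [fderiv_sub_const]
    have : fderiv ℝ (fun w => l (F w)) z = l.comp (fderiv ℝ F z) :=
      (l.hasFDerivAt.comp z hd.hasFDerivAt).fderiv
    rw [this]
    ext
    exact hf ⟨_, rfl⟩
  have hpos := hF.isPreconnected_sep
    (isConnected_frontier_halfPlane hconv hW.isCompact.isBounded hzW l hl0).isPreconnected
  have hneg := hF.isPreconnected_sep (isConnected_frontier_halfPlane hconv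
    hW.isCompact.isBounded hzW (-l) (neg_ne_zero.2 hl0)).isPreconnected
  obtain ⟨x, hx, hne⟩ := exists_clm_apply_ne hV.closure_interior hV.isCompact.isClosed hconv
    hW.isCompact.isBounded hW.simplyConnected.nonempty hcont hF hl0 (l (F z))
  refine hne (sub_eq_zero.1 (eqOn_zero_of_critical_zero hV.isCompact hU
    (h := fun w => l (F w) - l (F z)) ?_ ?_ ?_ ?_ hz (sub_self _) hder x hx))
  · exact (l.continuous.comp_continuousOn hcont).sub continuousOn_const
  · exact (harmonicOnNhd_clm_comp hharm l).sub (harmonicOnNhd_const _)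
  · simpa only [sub_pos] using hpos
  · simpa using hneg

/-! ### From local homeomorphism to bijection -/

/-- A continuous map on a compact set, respecting boundaries and a local homeomorphism in the
interior, is a bijection between the interiors if the interior of the target is convex. -/
theorem bijOn_interior_of_isLocalHomeomorphOn {V W : Set ℂ} (hV : IsCompact V)
    (hU : IsConnected (interior V)) (hconv : Convex ℝ W) {F : ℂ → ℂ} (hcont : ContinuousOn F V)
    (hfr : MapsTo F (frontier V) (frontier W)) (hint : MapsTo F (interior V) (interior W))
    (hloc : IsLocalHomeomorphOn F (interior V)) : BijOn F (interior V) (interior W) := by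
  have : CompactSpace V := isCompact_iff_compactSpace.1 hV
  obtain ⟨z, hz⟩ := hU.nonempty
  have := hconv.interior.contractibleSpace ⟨F z, hint hz⟩
  have := isOpen_interior.locallyPathConnectedSpace (U := interior W)
  have : PreconnectedSpace (interior V) := isPreconnected_iff_preconnectedSpace.1 hU.isPreconnected
  set p : V → ℂ := V.domRestrict F with hp
  have hpc : Continuous p := continuousOn_iff_continuous_domRestrict.1 hcont
  have hpre : ∀ x : V, p x ∈ interior W → (x : ℂ) ∈ interior V := by
    intro x hx
    refine (mem_interior_or_mem_frontier hV.isClosed x.2).resolve_right fun h => ?_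
    exact (hfr h).2 hx
  have hval : IsLocalHomeomorphOn (Subtype.val : V → ℂ) (p ⁻¹' interior W) := by
    refine (isLocalHomeomorphOn_iff_isOpenEmbedding_restrict _).2 fun x hx =>
      ⟨Subtype.val ⁻¹' interior V,
        (isOpen_interior.preimage continuous_subtype_val).mem_nhds (hpre x hx), ?_⟩
    refine ⟨Topology.IsEmbedding.subtypeVal.comp Topology.IsEmbedding.subtypeVal, ?_⟩
    convert! isOpen_interior (s := V) using 1
    ext y
    simp only [mem_range]
    exact ⟨fun ⟨a, ha⟩ => ha ▸ a.2, fun hy => ⟨⟨⟨y, interior_subset hy⟩, hy⟩, rfl⟩⟩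
  -- Working on the compact space `V` is what turns a local homeomorphism into a covering over the
  -- interior of `W`.
  have cov : IsCoveringMapOn p (interior W) :=
    .of_isLocalHomeomorphOn hpc (hloc.comp hval fun x hx => hpre x hx)
  -- The interior of `W` is convex, hence simply connected, so its inclusion lifts to a section of
  -- `F` through any prescribed point `e`.
  have lift : ∀ e : ℂ, e ∈ interior V → ∃ G : C(interior W, V),
      (∀ w (hw : w ∈ interior W), F (G ⟨w, hw⟩) = w) ∧
      ∀ h : F e ∈ interior W, (G ⟨F e, h⟩ : ℂ) = e := by
    intro e he
    obtain ⟨G, ⟨hG1, hG2⟩, -⟩ := cov.existsUnique_continuousMap_lifts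
      (⟨Subtype.val, continuous_subtype_val⟩ : C(interior W, ℂ)) (a₀ := ⟨F e, hint he⟩)
      (e₀ := ⟨e, interior_subset he⟩) rfl (fun a => a.2)
    exact ⟨G, fun w hw => congrFun hG2 ⟨w, hw⟩, fun h => congrArg Subtype.val hG1⟩
  refine ⟨hint, fun e he e' he' hee => ?_, fun w hw => ?_⟩
  · obtain ⟨G, hG1, hG2⟩ := lift e he
    have hmem : ∀ w : interior W, p (G w) ∈ interior W := fun w => by
      have : p (G w) = w := hG1 w w.2
      exact this ▸ w.2
    let g₁ : interior V → p ⁻¹' interior W := fun x => ⟨⟨x, interior_subset x.2⟩, hint x.2⟩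
    let g₂ : interior V → p ⁻¹' interior W := fun x => ⟨G ⟨F x, hint x.2⟩, hmem _⟩
    have c₁ : Continuous g₁ := by fun_prop
    have c₂ : Continuous g₂ := by
      refine Continuous.subtype_mk (G.continuous.comp (Continuous.subtype_mk ?_ _)) _
      exact continuousOn_iff_continuous_domRestrict.1 (hcont.mono interior_subset)
    -- The inclusion and `G ∘ F` are lifts of `F` on the connected interior of `V` that agree at
    -- `e`. So `G` is a left inverse of `F`, which gives injectivity.
    have heq := cov.isCoveringMap_restrictPreimage.eq_of_comp_eq c₁ c₂
      (funext fun x => Subtype.ext (hG1 _ (hint x.2)).symm) ⟨e, he⟩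
      (Subtype.ext (Subtype.ext (hG2 (hint he)).symm))
    have h' : e' = G ⟨F e', hint he'⟩ :=
      congrArg (fun g : interior V → p ⁻¹' interior W => ((g ⟨e', he'⟩ : V) : ℂ)) heq
    rw [h', ← hG2 (hint he)]
    simp only [hee]
  · obtain ⟨G, hG1, -⟩ := lift z hz
    have hGw : p (G ⟨w, hw⟩) = w := hG1 w hw
    exact ⟨G ⟨w, hw⟩, hpre _ (hGw.symm ▸ hw), hGw⟩

end HarmonicBijection

theorem theorem2 (V W : Set ℂ)
    (hV : HarmonicBijection.IsSimplyConnectedDomain V)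
    (hW : HarmonicBijection.IsSimplyConnectedDomain W)
    (hWconv : Convex ℝ W)
    (F : ℂ → ℂ)
    (hharm : HarmonicBijection.IsHarmonicMap F V)
    (hcont : ContinuousOn F V)
    (hC1 : ContDiffOn ℝ 1 F (interior V))
    (hhomeo : HarmonicBijection.RestrictsToHomeo F (frontier V) (frontier W))
    (horient : HarmonicBijection.PreservesBoundaryOrientation F V W) :
    Set.BijOn F V W := by
  have hint := HarmonicBijection.mapsTo_interior hV hW hWconv hharm hcont hhomeo
  have hfr := hhomeo.bijOn
  have hloc : IsLocalHomeomorphOn F (interior V) := by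
    intro z hz
    have hc : ContDiffAt ℝ 1 F z := hC1.contDiffAt (isOpen_interior.mem_nhds hz)
    have hd := hc.differentiableAt one_ne_zero
    have hrange := HarmonicBijection.range_fderiv_eq_top hV hW hWconv hharm hcont hhomeo hz hd
    have hker : (fderiv ℝ F z).ker = ⊥ := LinearMap.ker_eq_bot_iff_range_eq_top.2 hrange
    let e := ContinuousLinearEquiv.ofBijective (fderiv ℝ F z) hker hrange
    have hs : HasFDerivAt F (e : ℂ →L[ℝ] ℂ) z := by
      rw [ContinuousLinearEquiv.coe_ofBijective]
      exact hd.hasFDerivAt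
    exact ⟨hc.toOpenPartialHomeomorph F hs one_ne_zero,
      hc.mem_toOpenPartialHomeomorph_source hs one_ne_zero, rfl⟩
  have hbij := HarmonicBijection.bijOn_interior_of_isLocalHomeomorphOn hV.isCompact
    hV.simplyConnected.isPathConnected.isConnected hWconv hcont hfr.mapsTo hint hloc
  have hVu : V = interior V ∪ frontier V := by
    rw [← closure_eq_interior_union_frontier, hV.isCompact.isClosed.closure_eq]
  have hWu : W = interior W ∪ frontier W := by
    rw [← closure_eq_interior_union_frontier, hW.isCompact.isClosed.closure_eq]
  rw [hVu, hWu]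
  refine hbij.union hfr ?_
  rintro x (hx | hx) y (hy | hy) hxy
  · exact hbij.injOn hx hy hxy
  · exact absurd (hint hx) (hxy ▸ (hfr.mapsTo hy).2)
  · exact absurd (hint hy) (hxy ▸ (hfr.mapsTo hx).2)
  · exact hfr.injOn hx hy hxy
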